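/- Let $K,\mathbb{k}\in\{\mathbb{R},\mathbb{C}\}$ with $K\subseteq\mathbb{k}$. Let $\mathfrak n$ be a finite-dimensional $\nu$-step nilpotent $K$-Lie algebra with lower central series $\mathfrak n=\mathfrak n^{(1)}\supset\dots\supset\mathfrak n^{(\nu)}\neq 0$, $\mathfrak n^{(\nu+1)}=0$, where $\mathfrak n^{(i+1)}=[\mathfrak n,\mathfrak n^{(i)}]$. Suppose that $\mathfrak n$ is naturally graded: there are subspaces $\mathfrak a^{(i)}\subset\mathfrak n$ with $\mathfrak n^{(i)}=\mathfrak n^{(i+1)}\oplus\mathfrak a^{(i)}$ and $[\mathfrak a^{(i)},\mathfrak a^{(j)}]\subset\mathfrak a^{(i+j)}$ for all $i,j\ge 1$. Let $\mathfrak g$ be a finite-dimensional $\mathbb{k}$-Lie algebra, and let $$F\Big(\bigwedge\mathfrak n^*,\mathfrak g\Big)=\Big\{\omega\in \mathfrak n^*\otimes_K\mathfrak g:\ d\omega+\tfrac12[\omega,\omega]=0 \text{ in } \textstyle\bigwedge^2\mathfrak n^*\otimes_K\mathfrak g\Big\},$$ where $d$ is induced by the Chevalley–Eilenberg differential $(d\alpha)(x,y)=-\alpha([x,y])$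 and $[\alpha\otimes x,\beta\otimes y]=(\alpha\wedge\beta)\otimes[x,y]$. Then the analytic germ of $F(\bigwedge\mathfrak n^*,\mathfrak g)$ at $0$, defined by the coordinates of $d\omega+\frac12[\omega,\omega]$, is cut out by polynomial equations of degree at most $\nu+1$. That is, there are an $m$ and polynomials $p_1,\dots,p_k\in\mathbb{k}[t_1,\dots,t_m]$ of degree at most $\nu+1$ without constant and linear terms such that the germ is equivalent to the germ at $0\in\mathbb{k}^m$ defined by $p_1=\dots=p_k=0$. Here germs at the origins of $\mathbb{k}^N$ and $\mathbb{k}^m$ defined by analytic equations generating the ideals $I$ and $J$ of germs of analytic functions are called equivalent if there are germs of analytic maps $\varphi:(\mathbb{k}^N,0)\to(\mathbb{k}^m,0)$ and $\psi:(\mathbb{k}^m,0)\to(\mathbb{k}^N,0)$ with $\varphi^*J\subseteq I$, $\psi^*I\subseteq J$, $\psi\circ\varphi\equiv\mathrm{id}$ modulo $I$ and $\varphi\circ\psi\equiv\mathrm{id}$ modulo $J$ (equivalently, the analytic local algebras of the two germs are isomorphic). -/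

import Mathlib

open scoped TensorProduct Topology

noncomputable section

/-! ## Analytic germs -/

/-- An analytic germ at the origin of `𝕜ⁿ`, presented by finitely many analytic equations
`f₁(z) = 0, …, f_k(z) = 0` that vanish at the origin. -/
structure AnalyticGerm (𝕜 : Type*) [RCLike 𝕜] where
  /-- the dimension `n` of the ambient space -/
  dim : ℕ
  /-- the number `k` of equations -/
  numEqn : ℕ
  /-- the left-hand sides `f₁, …, f_k` of the equations -/
  eqn : Fin numEqn → (Fin dim → 𝕜) → 𝕜
  analyticAt_eqn : ∀ j, AnalyticAt 𝕜 (eqn j) 0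
  eqn_zero : ∀ j, eqn j 0 = 0

namespace AnalyticGerm

/-- The germ at `0` of the function `h` lies in the ideal `(f₁, …, f_k)` generated by the equations
of `X` in the ring `𝕜{z₁, …, z_n}` of germs of analytic functions. -/
def InIdeal {𝕜 : Type*} [RCLike 𝕜] (X : AnalyticGerm 𝕜) (h : (Fin X.dim → 𝕜) → 𝕜) : Prop :=
  ∃ a : Fin X.numEqn → (Fin X.dim → 𝕜) → 𝕜,
    (∀ j, AnalyticAt 𝕜 (a j) 0) ∧ h =ᶠ[𝓝 0] fun z => ∑ j, a j z * X.eqn j z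

/-- `φ` induces a morphism of (possibly non-reduced) analytic germs `X → Y`: it is analytic at `0`,
maps `0` to `0` and pulls the ideal of `Y` back into the ideal of `X`. -/
structure IsMorphism {𝕜 : Type*} [RCLike 𝕜] (X Y : AnalyticGerm 𝕜)
    (φ : (Fin X.dim → 𝕜) → (Fin Y.dim → 𝕜)) : Prop where
  analyticAt : AnalyticAt 𝕜 φ 0
  map_zero : φ 0 = 0
  pullback_mem : ∀ j, X.InIdeal (fun z => Y.eqn j (φ z))

/-- Equivalence of analytic germs: morphisms `φ : X → Y` and `ψ : Y → X` with `ψ ∘ φ = id` on `X`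
and `φ ∘ ψ = id` on `Y`. Two maps agree as morphisms out of `X` when their coordinates agree modulo
the ideal of `X`, so this is the same as an isomorphism of the analytic local algebras
`𝕜{z}/(f) ≅ 𝕜{w}/(g)`. -/
def Equivalent {𝕜 : Type*} [RCLike 𝕜] (X Y : AnalyticGerm 𝕜) : Prop :=
  ∃ (φ : (Fin X.dim → 𝕜) → (Fin Y.dim → 𝕜)) (ψ : (Fin Y.dim → 𝕜) → (Fin X.dim → 𝕜)),
    IsMorphism X Y φ ∧ IsMorphism Y X ψ ∧
    (∀ i, X.InIdeal (fun z => ψ (φ z) i - z i)) ∧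
    (∀ i, Y.InIdeal (fun w => φ (ψ w) i - w i))

/-- The germ at the origin defined by polynomial equations with zero constant terms. -/
def ofPolynomials {𝕜 : Type*} [RCLike 𝕜] {m k : ℕ} (p : Fin k → MvPolynomial (Fin m) 𝕜)
    (hp : ∀ j, (p j).coeff 0 = 0) : AnalyticGerm 𝕜 where
  dim := m
  numEqn := k
  eqn j z := MvPolynomial.eval z (p j)
  analyticAt_eqn j := by
    have h := AnalyticOnNhd.eval_mvPolynomial (𝕜 := 𝕜) (p j) 0 (Set.mem_univ _)
    exact h
  eqn_zero j := by
    rw [MvPolynomial.eval_zero]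
    exact hp j

/-- `X` is cut out by polynomial equations of degree at most `r`: it is equivalent to the germ at
the origin of some `𝕜ᵐ` defined by polynomials of degree at most `r` with trivial linear terms. -/
def IsCutOutInDegree {𝕜 : Type*} [RCLike 𝕜] (X : AnalyticGerm 𝕜) (r : ℕ) : Prop :=
  ∃ (m k : ℕ) (p : Fin k → MvPolynomial (Fin m) 𝕜) (hp : ∀ j, (p j).coeff 0 = 0),
    (∀ j, (p j).totalDegree ≤ r) ∧
    (∀ j i, (p j).coeff (Finsupp.single i 1) = 0) ∧
    X.Equivalent (ofPolynomials p hp)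

end AnalyticGerm

/-! ## Naturally graded nilpotent Lie algebras -/

/-- `𝔫` is `ν`-step nilpotent: `𝔫 = 𝔫⁽¹⁾ ⊃ … ⊃ 𝔫⁽ᵛ⁾ ≠ 0` and `𝔫⁽ᵛ⁺¹⁾ = 0`. The term `𝔫⁽ⁱ⁺¹⁾` of the
lower central series is `LieModule.lowerCentralSeries K 𝔫 𝔫 i`. -/
def IsStepNilpotent (K 𝔫 : Type*) [Field K] [LieRing 𝔫] [LieAlgebra K 𝔫] (ν : ℕ) : Prop :=
  LieModule.lowerCentralSeries K 𝔫 𝔫 ν = ⊥ ∧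
    ∀ i < ν, LieModule.lowerCentralSeries K 𝔫 𝔫 i ≠ ⊥

/-- `𝔫` is naturally graded: there are subspaces `𝔞⁽ⁱ⁾`, `i ≥ 1`, with
`𝔫⁽ⁱ⁾ = 𝔫⁽ⁱ⁺¹⁾ ⊕ 𝔞⁽ⁱ⁾` and `[𝔞⁽ⁱ⁾, 𝔞⁽ʲ⁾] ⊆ 𝔞⁽ⁱ⁺ʲ⁾`. -/
def IsNaturallyGraded (K 𝔫 : Type*) [Field K] [LieRing 𝔫] [LieAlgebra K 𝔫] : Prop :=
  ∃ 𝔞 : ℕ → Submodule K 𝔫,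
    (∀ i, Disjoint (LieModule.lowerCentralSeries K 𝔫 𝔫 (i + 1)).toSubmodule (𝔞 (i + 1)) ∧
      (LieModule.lowerCentralSeries K 𝔫 𝔫 (i + 1)).toSubmodule ⊔ 𝔞 (i + 1) =
        (LieModule.lowerCentralSeries K 𝔫 𝔫 i).toSubmodule) ∧
    ∀ i j, 1 ≤ i → 1 ≤ j → ∀ x ∈ 𝔞 i, ∀ y ∈ 𝔞 j, ⁅x, y⁆ ∈ 𝔞 (i + j)

/-! ## The Maurer–Cartan variety of `⋀𝔫* ⊗ 𝔤`

Only the degrees one and two of the differential graded algebra `⋀𝔫*` occur in the Maurer–Cartan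
equation. Here `⋀¹𝔫*` is the dual space and `⋀²𝔫*` the space of alternating bilinear forms. -/

namespace MaurerCartan

/-- `⋀¹𝔫* = 𝔫*`. -/
abbrev OneForm (K 𝔫 : Type*) [Field K] [LieRing 𝔫] [LieAlgebra K 𝔫] :=
  LieModule.Cohomology.oneCochain K 𝔫 K

/-- `⋀²𝔫*`: the alternating bilinear forms on `𝔫`. -/
abbrev TwoForm (K 𝔫 : Type*) [Field K] [LieRing 𝔫] [LieAlgebra K 𝔫] :=
  LieModule.Cohomology.twoCochain K 𝔫 K

/-- The Chevalley–Eilenberg differential `⋀¹𝔫* → ⋀²𝔫*`, `(dα)(x, y) = -α([x, y])`. -/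
def ceD (K 𝔫 : Type*) [Field K] [LieRing 𝔫] [LieAlgebra K 𝔫] :
    OneForm K 𝔫 →ₗ[K] TwoForm K 𝔫 where
  toFun α := ⟨LinearMap.mk₂ K (fun x y => -α ⁅x, y⁆)
      (by intros; simp; ring) (by intros; simp) (by intros; simp; ring) (by intros; simp),
    fun x => by simp⟩
  map_add' α β := by
    apply Subtype.ext; ext x y; simp; ring
  map_smul' c α := by
    apply Subtype.ext; ext x y; simp

/-- The wedge product `⋀¹𝔫* × ⋀¹𝔫* → ⋀²𝔫*`, `(α ∧ β)(x, y) = α(x) β(y) - α(y) β(x)`. -/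
def wedge (K 𝔫 : Type*) [Field K] [LieRing 𝔫] [LieAlgebra K 𝔫] :
    OneForm K 𝔫 →ₗ[K] OneForm K 𝔫 →ₗ[K] TwoForm K 𝔫 :=
  LinearMap.mk₂ K
    (fun α β => ⟨LinearMap.mk₂ K (fun x y => α x * β y - α y * β x)
        (by intros; simp; ring) (by intros; simp; ring) (by intros; simp; ring)
        (by intros; simp; ring),
      fun x => by simp⟩)
    (by intros; apply Subtype.ext; ext x y; simp; ring)
    (by intros; apply Subtype.ext; ext x y; simp; ring)
    (by intros; apply Subtype.ext; ext x y; simp; ring)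
    (by intros; apply Subtype.ext; ext x y; simp; ring)

section

variable (K 𝕜 𝔫 𝔤 : Type*) [RCLike K] [RCLike 𝕜] [Algebra K 𝕜]
  [LieRing 𝔫] [LieAlgebra K 𝔫]
  [LieRing 𝔤] [LieAlgebra K 𝔤] [LieAlgebra 𝕜 𝔤] [IsScalarTower K 𝕜 𝔤]

/-- The degree one part `⋀¹𝔫* ⊗ 𝔤` of the differential graded Lie algebra, a `𝕜`-vector space
through `𝔤` (for which reason `𝔤` is written as the left factor). -/
abbrev L1 := 𝔤 ⊗[K] OneForm K 𝔫

/-- The degree two part `⋀²𝔫* ⊗ 𝔤` of the differential graded Lie algebra. -/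
abbrev L2 := 𝔤 ⊗[K] TwoForm K 𝔫

/-- The differential `d ⊗ id` from degree one to degree two. -/
def diff : L1 K 𝔫 𝔤 →ₗ[𝕜] L2 K 𝔫 𝔤 :=
  TensorProduct.AlgebraTensorModule.map LinearMap.id (ceD K 𝔫)

/-- The bracket `[α ⊗ x, β ⊗ y] = (α ∧ β) ⊗ [x, y]` of two elements of degree one. -/
def bracket : L1 K 𝔫 𝔤 →ₗ[𝕜] L1 K 𝔫 𝔤 →ₗ[𝕜] L2 K 𝔫 𝔤 :=
  (TensorProduct.AlgebraTensorModule.homTensorHomMap K 𝕜 𝕜 𝔤 (OneForm K 𝔫) 𝔤 (TwoForm K 𝔫)) ∘ₗ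
    TensorProduct.AlgebraTensorModule.map (LieModule.toEnd 𝕜 𝔤 𝔤 : 𝔤 →ₗ[𝕜] 𝔤 →ₗ[𝕜] 𝔤) (wedge K 𝔫)

/-- The left-hand side `dω + ½[ω, ω]` of the Maurer–Cartan equation. -/
def mcMap (ω : L1 K 𝔫 𝔤) : L2 K 𝔫 𝔤 :=
  diff K 𝕜 𝔫 𝔤 ω + (1 / 2 : 𝕜) • bracket K 𝕜 𝔫 𝔤 ω ω

/-- The variety `F(⋀𝔫*, 𝔤) = {ω ∈ ⋀¹𝔫* ⊗ 𝔤 : dω + ½[ω, ω] = 0}`. -/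
def mcVariety : Set (L1 K 𝔫 𝔤) := {ω | mcMap K 𝕜 𝔫 𝔤 ω = 0}

variable {K 𝕜 𝔫 𝔤}

/-- The analytic germ `(F(⋀𝔫*, 𝔤), 0)` in linear coordinates: a basis `b` of `⋀¹𝔫* ⊗ 𝔤` identifies
this space with `𝕜ᴺ`, and the equations are the coordinates of `dω + ½[ω, ω]` in a basis `c` of
`⋀²𝔫* ⊗ 𝔤`. -/
def mcGerm {N M : ℕ} (b : Module.Basis (Fin N) 𝕜 (L1 K 𝔫 𝔤))
    (c : Module.Basis (Fin M) 𝕜 (L2 K 𝔫 𝔤)) : AnalyticGerm 𝕜 where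
  dim := N
  numEqn := M
  eqn j z := c.repr (mcMap K 𝕜 𝔫 𝔤 (∑ i, z i • b i)) j
  analyticAt_eqn j := by
    simp only [mcMap, map_sum, map_smul, map_add, LinearMap.sum_apply, LinearMap.smul_apply,
      Finsupp.add_apply, Finsupp.smul_apply, Finsupp.finsetSum_apply, smul_eq_mul]
    have hz : ∀ i, AnalyticAt 𝕜 (fun z : Fin N → 𝕜 => z i) 0 := fun i =>
      (ContinuousLinearMap.proj (R := 𝕜) (φ := fun _ : Fin N => 𝕜) i).analyticAt 0
    refine AnalyticAt.add (Finset.univ.analyticAt_fun_sum fun i _ => (hz i).mul analyticAt_const)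
      (analyticAt_const.mul (Finset.univ.analyticAt_fun_sum fun i _ => (hz i).mul
        (Finset.univ.analyticAt_fun_sum fun k _ => (hz k).mul analyticAt_const)))
  eqn_zero j := by simp [mcMap]

/-- The equations of `mcGerm b c` cut out `F(⋀𝔫*, 𝔤)`. -/
theorem mcGerm_eqn_eq_zero_iff {N M : ℕ} (b : Module.Basis (Fin N) 𝕜 (L1 K 𝔫 𝔤))
    (c : Module.Basis (Fin M) 𝕜 (L2 K 𝔫 𝔤)) (z : Fin N → 𝕜) :
    (∀ j, (mcGerm b c).eqn j z = 0) ↔ ∑ i, z i • b i ∈ mcVariety K 𝕜 𝔫 𝔤 :=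
  (c.forall_coord_eq_zero_iff (x := mcMap K 𝕜 𝔫 𝔤 (∑ i, z i • b i)))

end

end MaurerCartan

end

noncomputable section

theorem LieAlgebra.map_lie_eq_sum {𝕜 𝔤 ι : Type*} [CommRing 𝕜] [LieRing 𝔤] [LieAlgebra 𝕜 𝔤]
    [Fintype ι] (e : Module.Basis ι 𝕜 𝔤)
    (l : 𝔤 →ₗ[𝕜] 𝕜) (x y : 𝔤) :
    l ⁅x, y⁆ = ∑ i, ∑ j, l ⁅e i, e j⁆ * (e.repr x i * e.repr y j) := by
  conv_lhs => rw [← e.sum_repr x, ← e.sum_repr y]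
  simp only [sum_lie, lie_sum, smul_lie, lie_smul, map_sum, map_smul,
    smul_eq_mul, Finset.mul_sum]
  rw [Finset.sum_comm]
  exact Finset.sum_congr rfl fun i _ => Finset.sum_congr rfl fun j _ => by ring

/-! ## Vector-valued functions in the ideal of a germ -/

namespace AnalyticGerm

section Ideal

variable {𝕜 : Type*} [RCLike 𝕜] {X : AnalyticGerm 𝕜}

theorem InIdeal.zero : X.InIdeal (fun _ => 0) :=
  ⟨fun _ _ => 0, fun _ => analyticAt_const, by simp⟩

theorem InIdeal.add {f g : (Fin X.dim → 𝕜) → 𝕜} (hf : X.InIdeal f) (hg : X.InIdeal g) :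
    X.InIdeal (fun z => f z + g z) := by
  obtain ⟨a, ha, hfa⟩ := hf
  obtain ⟨b, hb, hgb⟩ := hg
  refine ⟨fun j z => a j z + b j z, fun j => (ha j).add (hb j), ?_⟩
  filter_upwards [hfa, hgb] with z h₁ h₂
  simp only [h₁, h₂, add_mul, Finset.sum_add_distrib]

theorem InIdeal.mul_left {f g : (Fin X.dim → 𝕜) → 𝕜} (hg : AnalyticAt 𝕜 g 0)
    (hf : X.InIdeal f) : X.InIdeal (fun z => g z * f z) := by
  obtain ⟨a, ha, hfa⟩ := hf
  refine ⟨fun j z => g z * a j z, fun j => hg.mul (ha j), ?_⟩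
  filter_upwards [hfa] with z h
  simp only [h, Finset.mul_sum, mul_assoc]

theorem InIdeal.sum {ι : Type*} {s : Finset ι} {f : ι → (Fin X.dim → 𝕜) → 𝕜}
    (hf : ∀ i ∈ s, X.InIdeal (f i)) : X.InIdeal (fun z => ∑ i ∈ s, f i z) := by
  classical
  induction s using Finset.induction_on with
  | empty => simpa using InIdeal.zero
  | insert i s hi ih =>
    simp only [Finset.sum_insert hi]
    exact (hf i (by simp)).add (ih fun j hj => hf j (by simp [hj]))

theorem InIdeal.eqn (j : Fin X.numEqn) : X.InIdeal (X.eqn j) := by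
  classical
  refine ⟨fun i _ => if i = j then 1 else 0, fun _ => analyticAt_const, ?_⟩
  simp

end Ideal

section Vector

variable {𝕜 : Type*} [RCLike 𝕜] {V W : Type*} [AddCommGroup V] [Module 𝕜 V]
  [AddCommGroup W] [Module 𝕜 W] {n : ℕ} {X : AnalyticGerm 𝕜}

/-- All linear coordinates of the vector-valued function `h` are analytic at the origin. -/
def VecAnalytic (h : (Fin n → 𝕜) → V) : Prop :=
  ∀ l : V →ₗ[𝕜] 𝕜, AnalyticAt 𝕜 (fun z => l (h z)) 0

/-- All linear coordinates of the vector-valued function `h` lie in the ideal of `X`. -/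
def VecInIdeal (X : AnalyticGerm 𝕜) (h : (Fin X.dim → 𝕜) → V) : Prop :=
  ∀ l : V →ₗ[𝕜] 𝕜, X.InIdeal (fun z => l (h z))

theorem VecAnalytic.map {h : (Fin n → 𝕜) → V} (hh : VecAnalytic h) (L : V →ₗ[𝕜] W) :
    VecAnalytic (fun z => L (h z)) :=
  fun l => hh (l ∘ₗ L)

theorem _root_.LinearMap.vecAnalytic (L : (Fin n → 𝕜) →ₗ[𝕜] V) : VecAnalytic (fun z => L z) :=
  fun l => (LinearMap.toContinuousLinearMap (l ∘ₗ L)).analyticAt 0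

theorem VecAnalytic.sum {ι : Type*} {s : Finset ι} {h : ι → (Fin n → 𝕜) → V}
    (hh : ∀ i ∈ s, VecAnalytic (h i)) : VecAnalytic (fun z => ∑ i ∈ s, h i z) := by
  intro l
  simp only [map_sum]
  exact s.analyticAt_fun_sum fun i hi => hh i hi l

theorem VecInIdeal.zero : X.VecInIdeal (fun _ => (0 : V)) := fun l => by
  simpa using InIdeal.zero

theorem VecInIdeal.map {h : (Fin X.dim → 𝕜) → V} (hh : X.VecInIdeal h) (L : V →ₗ[𝕜] W) :
    X.VecInIdeal (fun z => L (h z)) :=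
  fun l => hh (l ∘ₗ L)

theorem VecInIdeal.add {f g : (Fin X.dim → 𝕜) → V} (hf : X.VecInIdeal f) (hg : X.VecInIdeal g) :
    X.VecInIdeal (fun z => f z + g z) := fun l => by
  simpa only [map_add] using (hf l).add (hg l)

theorem VecInIdeal.neg {f : (Fin X.dim → 𝕜) → V} (hf : X.VecInIdeal f) :
    X.VecInIdeal (fun z => -f z) :=
  hf.map (-LinearMap.id)

theorem VecInIdeal.sub {f g : (Fin X.dim → 𝕜) → V} (hf : X.VecInIdeal f) (hg : X.VecInIdeal g) :
    X.VecInIdeal (fun z => f z - g z) := by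
  simpa only [sub_eq_add_neg] using hf.add hg.neg

theorem VecInIdeal.sum {ι : Type*} {s : Finset ι} {f : ι → (Fin X.dim → 𝕜) → V}
    (hf : ∀ i ∈ s, X.VecInIdeal (f i)) : X.VecInIdeal (fun z => ∑ i ∈ s, f i z) := fun l => by
  simp only [map_sum]
  exact InIdeal.sum fun i hi => hf i hi l

theorem vecInIdeal_of_basis {ι : Type*} [Fintype ι] (e : Module.Basis ι 𝕜 V)
    {h : (Fin X.dim → 𝕜) → V} (hh : ∀ i, X.InIdeal (fun z => e.repr (h z) i)) :
    X.VecInIdeal h := by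
  intro l
  have : (fun z => l (h z)) = fun z => ∑ i, l (e i) * e.repr (h z) i := by
    funext z
    conv_lhs => rw [← e.sum_repr (h z), map_sum]
    simp only [map_smul, smul_eq_mul, mul_comm]
  rw [this]
  exact InIdeal.sum fun i _ => (hh i).mul_left analyticAt_const

theorem VecInIdeal.repr {ι : Type*} (e : Module.Basis ι 𝕜 V) {h : (Fin X.dim → 𝕜) → V}
    (hh : X.VecInIdeal h) (i : ι) : X.InIdeal (fun z => e.repr (h z) i) :=
  hh (e.coord i)

end Vector

section Lie

variable {𝕜 : Type*} [RCLike 𝕜] {𝔤 : Type*} [LieRing 𝔤] [LieAlgebra 𝕜 𝔤] [FiniteDimensional 𝕜 𝔤]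
  {n : ℕ} {X : AnalyticGerm 𝕜}

theorem VecAnalytic.lie {f g : (Fin n → 𝕜) → 𝔤} (hf : VecAnalytic f) (hg : VecAnalytic g) :
    VecAnalytic (fun z => ⁅f z, g z⁆) := by
  intro l
  simp only [fun z => LieAlgebra.map_lie_eq_sum (Module.finBasis 𝕜 𝔤) l (f z) (g z)]
  exact Finset.univ.analyticAt_fun_sum fun i _ => Finset.univ.analyticAt_fun_sum fun j _ =>
    analyticAt_const.mul ((hf ((Module.finBasis 𝕜 𝔤).coord i)).mul
      (hg ((Module.finBasis 𝕜 𝔤).coord j)))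

theorem VecInIdeal.lie_right {f g : (Fin X.dim → 𝕜) → 𝔤} (hf : VecAnalytic f)
    (hg : X.VecInIdeal g) : X.VecInIdeal (fun z => ⁅f z, g z⁆) := by
  intro l
  simp only [fun z => LieAlgebra.map_lie_eq_sum (Module.finBasis 𝕜 𝔤) l (f z) (g z)]
  exact InIdeal.sum fun i _ => InIdeal.sum fun j _ =>
    ((hg.repr (Module.finBasis 𝕜 𝔤) j).mul_left
      (hf ((Module.finBasis 𝕜 𝔤).coord i))).mul_left analyticAt_const

theorem VecInIdeal.lie_left {f g : (Fin X.dim → 𝕜) → 𝔤} (hf : X.VecInIdeal f)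
    (hg : VecAnalytic g) : X.VecInIdeal (fun z => ⁅f z, g z⁆) := by
  simpa only [lie_skew] using (VecInIdeal.lie_right hg hf).neg

end Lie

/-! ## Polynomial maps with bounds on the degrees of their monomials -/

section Poly

variable {𝕜 : Type*} [RCLike 𝕜] {V W : Type*} [AddCommGroup V] [Module 𝕜 V]
  [AddCommGroup W] [Module 𝕜 W] {m : ℕ} {a b : ℕ}

/-- All linear coordinates of `h` are polynomials whose monomials have degrees in `[a, b]`. -/
def IsPolyMap (a b : ℕ) (h : (Fin m → 𝕜) → V) : Prop :=
  ∀ l : V →ₗ[𝕜] 𝕜, ∃ p : MvPolynomial (Fin m) 𝕜,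
    (∀ d ∈ p.support, a ≤ d.degree ∧ d.degree ≤ b) ∧ ∀ z, MvPolynomial.eval z p = l (h z)

theorem IsPolyMap.vecAnalytic {h : (Fin m → 𝕜) → V} (hh : IsPolyMap a b h) :
    VecAnalytic h := by
  intro l
  obtain ⟨p, -, hp⟩ := hh l
  simp only [← hp]
  exact AnalyticOnNhd.eval_mvPolynomial (𝕜 := 𝕜) p 0 (Set.mem_univ _)

theorem IsPolyMap.mono {a' b' : ℕ} {h : (Fin m → 𝕜) → V} (hh : IsPolyMap a b h) (ha : a' ≤ a)
    (hb : b ≤ b') : IsPolyMap a' b' h := fun l =>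
  let ⟨p, hp, hpl⟩ := hh l
  ⟨p, fun d hd => ⟨ha.trans (hp d hd).1, (hp d hd).2.trans hb⟩, hpl⟩

theorem IsPolyMap.map {h : (Fin m → 𝕜) → V} (hh : IsPolyMap a b h) (L : V →ₗ[𝕜] W) :
    IsPolyMap a b (fun z => L (h z)) :=
  fun l => hh (l ∘ₗ L)

theorem IsPolyMap.sum {ι : Type*} {s : Finset ι} {h : ι → (Fin m → 𝕜) → V}
    (hh : ∀ i ∈ s, IsPolyMap a b (h i)) : IsPolyMap a b (fun z => ∑ i ∈ s, h i z) := by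
  classical
  intro l
  choose! p hp hpl using fun i hi => hh i hi l
  refine ⟨∑ i ∈ s, p i, fun d hd => ?_, fun z => ?_⟩
  · obtain ⟨i, hi, hd⟩ := Finset.mem_biUnion.1 (MvPolynomial.support_sum hd)
    exact hp i hi d hd
  · simp only [map_sum]
    exact Finset.sum_congr rfl fun i hi => hpl i hi z

theorem IsPolyMap.sub {f g : (Fin m → 𝕜) → V} (hf : IsPolyMap a b f) (hg : IsPolyMap a b g) :
    IsPolyMap a b (fun z => f z - g z) := by
  have h := IsPolyMap.sum (s := Finset.univ) (h := fun (i : Fin 2) z => ![f z, -g z] i)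
    (a := a) (b := b) fun i _ => by
      fin_cases i
      · exact hf
      · exact hg.map (-LinearMap.id)
  simpa [Fin.sum_univ_two, sub_eq_add_neg] using h

theorem _root_.LinearMap.isPolyMap (L : (Fin m → 𝕜) →ₗ[𝕜] V) : IsPolyMap 1 1 (fun z => L z) := by
  classical
  intro l
  refine ⟨∑ i, MvPolynomial.C (l (L (Pi.single i 1))) * MvPolynomial.X i, fun d hd => ?_,
    fun z => ?_⟩
  · obtain ⟨i, -, hd⟩ := Finset.mem_biUnion.1 (MvPolynomial.support_sum hd)
    have h := MvPolynomial.support_mul _ _ hd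
    rw [MvPolynomial.support_X] at h
    obtain ⟨d₁, h₁, d₂, h₂, rfl⟩ := Finset.mem_add.1 h
    have h₁ : d₁ = 0 := by
      have := MvPolynomial.support_monomial_subset h₁
      simpa using this
    simp_all
  · conv_rhs => rw [pi_eq_sum_univ' z]
    simp [mul_comm]

theorem IsPolyMap.lie {𝔤 : Type*} [LieRing 𝔤] [LieAlgebra 𝕜 𝔤] [FiniteDimensional 𝕜 𝔤]
    {a' b' : ℕ} {f g : (Fin m → 𝕜) → 𝔤} (hf : IsPolyMap a b f) (hg : IsPolyMap a' b' g) :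
    IsPolyMap (a + a') (b + b') (fun z => ⁅f z, g z⁆) := by
  classical
  intro l
  set e := Module.finBasis 𝕜 𝔤
  choose p hp hpl using fun i => hf (e.coord i)
  choose q hq hql using fun i => hg (e.coord i)
  refine ⟨∑ i, ∑ j, l ⁅e i, e j⁆ • (p i * q j), fun d hd => ?_, fun z => ?_⟩
  · obtain ⟨i, -, hd⟩ := Finset.mem_biUnion.1 (MvPolynomial.support_sum hd)
    obtain ⟨j, -, hd⟩ := Finset.mem_biUnion.1 (MvPolynomial.support_sum hd)
    obtain ⟨d₁, h₁, d₂, h₂, rfl⟩ :=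
      Finset.mem_add.1 (MvPolynomial.support_mul _ _ (MvPolynomial.support_smul hd))
    have := hp i d₁ h₁
    have := hq j d₂ h₂
    rw [map_add]
    omega
  · rw [LieAlgebra.map_lie_eq_sum e]
    simp [hpl, hql, MvPolynomial.smul_eval]

end Poly

end AnalyticGerm

/-! ## Right-normed words in a Lie algebra -/

namespace LieWord

/-- The right-normed word `⁅f t₁, ⁅f t₂, … ⁅f t_k, f t₀⁆⁆⁆` of length `k + 1`. -/
def eval {ι L : Type*} [LieRing L] (f : ι → L) (t : ι) (T : List ι) : L :=
  T.foldr (fun s x => ⁅f s, x⁆) (f t)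

/-- The words of length at least two and at most `ν`. -/
abbrev Index (r ν : ℕ) := {T : Fin r × List (Fin r) // 1 ≤ T.2.length ∧ T.2.length < ν}

variable {K L : Type*} [Field K] [LieRing L] [LieAlgebra K L]

open LieModule (lowerCentralSeries)

theorem lie_mem_lowerCentralSeries {k : ℕ} (x : L) {y : L}
    (hy : y ∈ lowerCentralSeries K L L k) : ⁅x, y⁆ ∈ lowerCentralSeries K L L (k + 1) := by
  rw [LieModule.lowerCentralSeries_succ]
  exact LieSubmodule.lie_mem_lie (LieSubmodule.mem_top x) hy

theorem lie_mem_lowerCentralSeries_of_mem {k : ℕ} {x y : L}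
    (hx : x ∈ lowerCentralSeries K L L 1) (hy : y ∈ lowerCentralSeries K L L k) :
    ⁅x, y⁆ ∈ lowerCentralSeries K L L (k + 2) := by
  rw [LieModule.lowerCentralSeries_succ, ← LieSubmodule.mem_toSubmodule,
    LieSubmodule.lieIdeal_oper_eq_linear_span'] at hx
  induction hx using Submodule.span_induction with
  | mem z hz =>
    obtain ⟨a, -, b, -, rfl⟩ := hz
    rw [lie_lie]
    exact sub_mem
      (lie_mem_lowerCentralSeries _ (lie_mem_lowerCentralSeries _ hy))
      (lie_mem_lowerCentralSeries _ (lie_mem_lowerCentralSeries _ hy))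
  | zero => simp
  | add z w _ _ hz hw => rw [add_lie]; exact add_mem hz hw
  | smul c z _ hz => rw [smul_lie]; exact (lowerCentralSeries K L L _).smul_mem c hz

/-- The words of length greater than `k` and at most `ν`. -/
def words {ι : Type*} (u : ι → L) (k ν : ℕ) : Set L :=
  {x | ∃ t T, k ≤ T.length ∧ T.length < ν ∧ x = eval u t T}

theorem lowerCentralSeries_le_span_words_sup {ι : Type*} (u : ι → L)
    (hu : ⊤ ≤ Submodule.span K (Set.range u) ⊔ (lowerCentralSeries K L L 1).toSubmodule) (k : ℕ) :
    (lowerCentralSeries K L L k).toSubmodule ≤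
      Submodule.span K (words u k (k + 1)) ⊔ (lowerCentralSeries K L L (k + 1)).toSubmodule := by
  induction k with
  | zero =>
    refine le_top.trans (hu.trans (sup_le_sup_right (Submodule.span_mono ?_) _))
    rintro _ ⟨t, rfl⟩
    exact ⟨t, [], by simp [eval]⟩
  | succ k ih =>
    conv_lhs => rw [LieModule.lowerCentralSeries_succ, LieSubmodule.lieIdeal_oper_eq_linear_span']
    rw [Submodule.span_le]
    rintro _ ⟨x, -, y, hy, rfl⟩
    obtain ⟨v, hv, d, hd, rfl⟩ := Submodule.mem_sup.1 (hu (Submodule.mem_top (x := x)))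
    rw [add_lie]
    refine add_mem ?_ (Submodule.mem_sup_right (lie_mem_lowerCentralSeries_of_mem hd hy))
    obtain ⟨y₁, hy₁, y₂, hy₂, rfl⟩ := Submodule.mem_sup.1 (ih hy)
    rw [lie_add]
    refine add_mem (Submodule.mem_sup_left ?_)
      (Submodule.mem_sup_right (lie_mem_lowerCentralSeries _ hy₂))
    clear hy hy₂
    induction hv, hy₁ using Submodule.span_induction₂ with
    | mem_mem a b ha hb =>
      obtain ⟨s, rfl⟩ := ha
      obtain ⟨t, T, h₁, h₂, rfl⟩ := hb
      exact Submodule.subset_span ⟨t, s :: T, by simpa, by simp; omega, rfl⟩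
    | zero_left => simp
    | zero_right => simp
    | add_left a b c _ _ _ h₁ h₂ => rw [add_lie]; exact add_mem h₁ h₂
    | add_right a b c _ _ _ h₁ h₂ => rw [lie_add]; exact add_mem h₁ h₂
    | smul_left r a b _ _ h => rw [smul_lie]; exact Submodule.smul_mem _ _ h
    | smul_right r a b _ _ h => rw [lie_smul]; exact Submodule.smul_mem _ _ h

theorem lowerCentralSeries_le_span_words {ι : Type*} (u : ι → L)
    (hu : ⊤ ≤ Submodule.span K (Set.range u) ⊔ (lowerCentralSeries K L L 1).toSubmodule)
    {ν : ℕ} (hν : lowerCentralSeries K L L ν = ⊥) (k : ℕ) :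
    (lowerCentralSeries K L L k).toSubmodule ≤ Submodule.span K (words u k ν) := by
  rcases le_total ν k with h | h
  · have : lowerCentralSeries K L L k = ⊥ :=
      le_bot_iff.1 ((LieModule.antitone_lowerCentralSeries K L L h).trans hν.le)
    simp [this]
  · induction h using Nat.decreasingInduction with
    | self => simp [hν]
    | of_succ k hk ih =>
      refine (lowerCentralSeries_le_span_words_sup u hu k).trans (sup_le ?_ (ih.trans ?_))
      · exact Submodule.span_mono fun x ⟨t, T, h₁, h₂, hx⟩ => ⟨t, T, h₁, by omega, hx⟩
      · exact Submodule.span_mono fun x ⟨t, T, h₁, h₂, hx⟩ => ⟨t, T, by omega, h₂, hx⟩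

/-- A minimal system of generators `u` of a nilpotent Lie algebra, together with a linear way to
write every element in terms of `u` (with coefficients `τ`) and longer words in `u` (with
coefficients `σ`). -/
structure Presentation (K L : Type*) [Field K] [LieRing L] [LieAlgebra K L] (ν : ℕ) where
  rank : ℕ
  u : Fin rank → L
  τ : L →ₗ[K] Fin rank → K
  σ : L →ₗ[K] Index rank ν →₀ K
  τ_u : ∀ t, τ (u t) = Pi.single t 1
  τ_lie : ∀ x y : L, τ ⁅x, y⁆ = 0
  σ_u : ∀ t, σ (u t) = 0
  eq_sum : ∀ x, x = ∑ t, τ x t • u t +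
    Finsupp.linearCombination K (fun T : Index rank ν => eval u T.1.1 T.1.2) (σ x)

theorem Presentation.nonempty [FiniteDimensional K L] {ν : ℕ}
    (hν : lowerCentralSeries K L L ν = ⊥) : Nonempty (Presentation K L ν) := by
  classical
  set D : Submodule K L := (lowerCentralSeries K L L 1).toSubmodule
  let e := Module.finBasis K (L ⧸ D)
  choose u hu using fun t => D.mkQ_surjective (e t)
  let τ : L →ₗ[K] Fin (Module.finrank K (L ⧸ D)) → K := e.equivFun.toLinearMap ∘ₗ D.mkQ
  have hτu : ∀ t, τ (u t) = Pi.single t 1 := fun t => by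
    ext s
    simp [τ, hu, Pi.single_apply, eq_comm]
  have hτD : ∀ x ∈ D, τ x = 0 := fun x hx => by
    simp [τ, (Submodule.Quotient.mk_eq_zero D).2 hx]
  let ρ : L →ₗ[K] L := LinearMap.id - Fintype.linearCombination K u ∘ₗ τ
  have hρ : ∀ x, ρ x ∈ D := fun x => by
    rw [← Submodule.Quotient.mk_eq_zero, ← Submodule.mkQ_apply]
    simp only [ρ, τ, LinearMap.sub_apply, LinearMap.id_apply, LinearMap.comp_apply, map_sub,
      Fintype.linearCombination_apply, map_sum, map_smul, hu, LinearEquiv.coe_coe]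
    rw [e.sum_equivFun, sub_self]
  have hspan : ⊤ ≤ Submodule.span K (Set.range u) ⊔ D := fun x _ => by
    have : x = Fintype.linearCombination K u (τ x) + ρ x := by simp [ρ]
    rw [this]
    refine add_mem (Submodule.mem_sup_left ?_) (Submodule.mem_sup_right (hρ x))
    rw [← Fintype.range_linearCombination]
    exact LinearMap.mem_range_self _ _
  let q := Finsupp.linearCombination K
    (fun T : Index (Module.finrank K (L ⧸ D)) ν => eval u T.1.1 T.1.2)
  have hq : D ≤ LinearMap.range q := by
    refine (lowerCentralSeries_le_span_words u hspan hν 1).trans ?_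
    rw [Submodule.span_le]
    rintro _ ⟨t, T, h₁, h₂, rfl⟩
    exact ⟨Finsupp.single ⟨(t, T), h₁, h₂⟩ 1, by simp [q]⟩
  obtain ⟨g, hg⟩ := q.rangeRestrict.exists_rightInverse_of_surjective
    (LinearMap.range_eq_top.2 q.surjective_rangeRestrict)
  refine ⟨⟨_, u, τ, g ∘ₗ ρ.codRestrict (LinearMap.range q) fun x => hq (hρ x), hτu,
    fun x y => hτD _ (lie_mem_lowerCentralSeries (k := 0) x (by simp)), fun t => ?_, fun x => ?_⟩⟩
  · have : ρ.codRestrict (LinearMap.range q) (fun x => hq (hρ x)) (u t) = 0 := by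
      apply Subtype.ext
      simp [ρ, hτu, Fintype.linearCombination_apply, Pi.single_apply]
    simp [this]
  · have h : q (g (ρ.codRestrict (LinearMap.range q) (fun x => hq (hρ x)) x)) = ρ x :=
      congrArg Subtype.val (LinearMap.congr_fun hg _)
    change x = Fintype.linearCombination K u (τ x) + q (g _)
    rw [h]
    simp [ρ]

theorem Presentation.induction {ν : ℕ} (P : Presentation K L ν) {p : L → Prop}
    (u : ∀ t, p (P.u t)) (zero : p 0) (add : ∀ x y, p x → p y → p (x + y))
    (smul : ∀ (c : K) x, p x → p (c • x)) (lie : ∀ t x, p x → p ⁅P.u t, x⁆) (x : L) : p x := by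
  have hw : ∀ t T, p (eval P.u t T) := fun t T => by
    induction T with
    | nil => exact u t
    | cons s T ih => exact lie s _ ih
  let S : Submodule K L :=
    { carrier := {x | p x}, zero_mem' := zero, add_mem' := fun {x y} => add x y,
      smul_mem' := smul }
  change x ∈ S
  rw [P.eq_sum x]
  refine add_mem (sum_mem fun t _ => S.smul_mem _ (u t)) ?_
  rw [Finsupp.linearCombination_apply]
  exact sum_mem fun T _ => S.smul_mem _ (hw _ _)

end LieWord

/-! ## Evaluation of vector-valued forms -/

namespace MaurerCartan

variable (K 𝕜 : Type*) {𝔫 𝔤 : Type*} [RCLike K] [RCLike 𝕜] [Algebra K 𝕜]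
  [LieRing 𝔫] [LieAlgebra K 𝔫]
  [LieRing 𝔤] [LieAlgebra K 𝔤] [LieAlgebra 𝕜 𝔤] [IsScalarTower K 𝕜 𝔤]

/-- The value at `x` of a `𝔤`-valued one-form. -/
def evalOne (x : 𝔫) : L1 K 𝔫 𝔤 →ₗ[𝕜] 𝔤 :=
  (TensorProduct.AlgebraTensorModule.rid K 𝕜 𝔤).toLinearMap ∘ₗ
    TensorProduct.AlgebraTensorModule.map LinearMap.id (LinearMap.applyₗ x)

/-- The value at `(x, y)` of a `𝔤`-valued two-form. -/
def evalTwo (x y : 𝔫) : L2 K 𝔫 𝔤 →ₗ[𝕜] 𝔤 :=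
  (TensorProduct.AlgebraTensorModule.rid K 𝕜 𝔤).toLinearMap ∘ₗ
    TensorProduct.AlgebraTensorModule.map LinearMap.id
      (LinearMap.applyₗ y ∘ₗ LinearMap.applyₗ x ∘ₗ (TwoForm K 𝔫).subtype)

/-- The linear map `v ↦ v ⊗ a`. -/
def tmulRight {A : Type*} [AddCommMonoid A] [Module K A] (a : A) : 𝔤 →ₗ[𝕜] 𝔤 ⊗[K] A where
  toFun v := v ⊗ₜ a
  map_add' v w := TensorProduct.add_tmul v w a
  map_smul' _ _ := rfl

@[simp]
theorem tmulRight_apply {A : Type*} [AddCommMonoid A] [Module K A] (a : A) (v : 𝔤) :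
    tmulRight K 𝕜 a v = v ⊗ₜ[K] a := rfl

@[simp]
theorem evalOne_tmul (x : 𝔫) (v : 𝔤) (α : OneForm K 𝔫) :
    evalOne K 𝕜 x (v ⊗ₜ[K] α) = α x • v := by
  simp [evalOne]

@[simp]
theorem evalTwo_tmul (x y : 𝔫) (v : 𝔤) (β : TwoForm K 𝔫) :
    evalTwo K 𝕜 x y (v ⊗ₜ[K] β) = β x y • v := by
  simp [evalTwo]

@[simp]
theorem ceD_apply (α : OneForm K 𝔫) (x y : 𝔫) : ceD K 𝔫 α x y = -α ⁅x, y⁆ := rfl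

@[simp]
theorem wedge_apply (α β : OneForm K 𝔫) (x y : 𝔫) :
    wedge K 𝔫 α β x y = α x * β y - α y * β x := rfl

variable {𝕜} in
theorem evalOne_add (x y : 𝔫) (ω : L1 K 𝔫 𝔤) :
    evalOne K 𝕜 (x + y) ω = evalOne K 𝕜 x ω + evalOne K 𝕜 y ω := by
  induction ω using TensorProduct.induction_on with
  | zero => simp
  | tmul v α => simp [add_smul]
  | add a b ha hb => simp only [map_add, ha, hb]; abel

variable {𝕜} in
theorem evalOne_smul (c : K) (x : 𝔫) (ω : L1 K 𝔫 𝔤) :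
    evalOne K 𝕜 (c • x) ω = c • evalOne K 𝕜 x ω := by
  induction ω using TensorProduct.induction_on with
  | zero => simp
  | tmul v α => simp [mul_smul]
  | add a b ha hb => simp only [map_add, ha, hb, smul_add]

theorem evalTwo_diff (x y : 𝔫) (ω : L1 K 𝔫 𝔤) :
    evalTwo K 𝕜 x y (diff K 𝕜 𝔫 𝔤 ω) = -evalOne K 𝕜 ⁅x, y⁆ ω := by
  induction ω using TensorProduct.induction_on with
  | zero => simp
  | tmul v α => simp [diff]
  | add a b ha hb => simp only [map_add, ha, hb, neg_add]

theorem evalTwo_bracket (x y : 𝔫) (ω η : L1 K 𝔫 𝔤) :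
    evalTwo K 𝕜 x y (bracket K 𝕜 𝔫 𝔤 ω η) =
      ⁅evalOne K 𝕜 x ω, evalOne K 𝕜 y η⁆ - ⁅evalOne K 𝕜 y ω, evalOne K 𝕜 x η⁆ := by
  induction ω using TensorProduct.induction_on with
  | zero => simp
  | tmul v α =>
    induction η using TensorProduct.induction_on with
    | zero => simp
    | tmul w β => 
      have h : bracket K 𝕜 𝔫 𝔤 (v ⊗ₜ α) (w ⊗ₜ β) = ⁅v, w⁆ ⊗ₜ wedge K 𝔫 α β := by simp [bracket]
      rw [h, evalTwo_tmul, wedge_apply]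
      simp only [evalOne_tmul, smul_lie, lie_smul, sub_smul, mul_smul]
      rw [smul_comm (α x), smul_comm (α y)]
    | add a b ha hb => simp only [map_add, ha, hb, lie_add]; abel
  | add a b ha hb => simp only [map_add, LinearMap.add_apply, ha, hb, add_lie]; abel

theorem evalTwo_mcMap (x y : 𝔫) (ω : L1 K 𝔫 𝔤) :
    evalTwo K 𝕜 x y (mcMap K 𝕜 𝔫 𝔤 ω) =
      ⁅evalOne K 𝕜 x ω, evalOne K 𝕜 y ω⁆ - evalOne K 𝕜 ⁅x, y⁆ ω := by
  rw [mcMap, map_add, map_smul, evalTwo_diff, evalTwo_bracket,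
    ← lie_skew (evalOne K 𝕜 y ω) (evalOne K 𝕜 x ω), sub_neg_eq_add, ← two_smul 𝕜, smul_smul]
  norm_num
  abel

variable {ι : Type*} [Fintype ι] (e : Module.Basis ι K 𝔫)

/-- The `𝔤`-valued one-form with prescribed values on a basis. -/
def ofValues : (ι → 𝔤) →ₗ[𝕜] L1 K 𝔫 𝔤 :=
  ∑ i, tmulRight K 𝕜 (e.coord i) ∘ₗ LinearMap.proj i

theorem ofValues_apply (f : ι → 𝔤) : ofValues K 𝕜 e f = ∑ i, f i ⊗ₜ[K] e.coord i := by
  simp [ofValues]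

theorem ofValues_evalOne (ω : L1 K 𝔫 𝔤) :
    ofValues K 𝕜 e (fun i => evalOne K 𝕜 (e i) ω) = ω := by
  rw [ofValues_apply]
  induction ω using TensorProduct.induction_on with
  | zero => simp
  | tmul v α =>
    simp only [evalOne_tmul, TensorProduct.smul_tmul, ← TensorProduct.tmul_sum]
    congr 1
    ext x
    conv_rhs => rw [← e.sum_repr x]
    simp
  | add a b ha hb =>
    simp only [map_add, TensorProduct.add_tmul, Finset.sum_add_distrib, ha, hb]

theorem evalOne_ofValues (f : 𝔫 →ₗ[K] 𝔤) (x : 𝔫) :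
    evalOne K 𝕜 x (ofValues K 𝕜 e fun i => f (e i)) = f x := by
  conv_rhs => rw [← e.sum_repr x, map_sum]
  simp only [ofValues_apply, map_sum, evalOne_tmul, Module.Basis.coord_apply, map_smul]

theorem sum_evalTwo_tmul_wedge (θ : L2 K 𝔫 𝔤) :
    ∑ i, ∑ j, evalTwo K 𝕜 (e i) (e j) θ ⊗ₜ[K] ((1 / 2 : K) • wedge K 𝔫 (e.coord i) (e.coord j)) =
      θ := by
  induction θ using TensorProduct.induction_on with
  | zero => simp
  | tmul v β =>
    simp only [evalTwo_tmul, TensorProduct.smul_tmul, ← TensorProduct.tmul_sum]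
    congr 1
    have key : ∀ x y, ∑ i, ∑ j, β (e i) (e j) * (e.repr x i * e.repr y j) = β x y := by
      intro x y
      conv_rhs => rw [← e.sum_repr x, ← e.sum_repr y]
      rw [← LieModule.Cohomology.twoCochain_val_apply]
      simp only [map_sum, map_smul, LinearMap.sum_apply, LinearMap.smul_apply, smul_eq_mul,
        Finset.mul_sum]
      rw [Finset.sum_comm]
      exact Finset.sum_congr rfl fun i _ => Finset.sum_congr rfl fun j _ => by
        rw [← LieModule.Cohomology.twoCochain_val_apply]; ring
    apply Subtype.ext
    ext x y
    simp only [Submodule.coe_sum, Submodule.coe_smul, LinearMap.sum_apply, LinearMap.smul_apply,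
      LieModule.Cohomology.twoCochain_val_apply, wedge_apply, Module.Basis.coord_apply,
      smul_eq_mul]
    have hs := LieModule.Cohomology.twoCochain_skew β x y
    calc _ = 1 / 2 * (∑ i, ∑ j, β (e i) (e j) * (e.repr x i * e.repr y j) -
          ∑ i, ∑ j, β (e i) (e j) * (e.repr y i * e.repr x j)) := by
          simp only [← Finset.sum_sub_distrib, Finset.mul_sum]
          exact Finset.sum_congr rfl fun i _ => Finset.sum_congr rfl fun j _ => by ring
      _ = β x y := by rw [key, key, ← hs]; ring
  | add a b ha hb =>
    simp only [map_add, TensorProduct.add_tmul, Finset.sum_add_distrib, ha, hb]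

end MaurerCartan

/-! ## Extending values on generators to a nilpotent Lie algebra -/

namespace AnalyticGerm

variable {K 𝕜 V : Type*} [RCLike K] [RCLike 𝕜] [Algebra K 𝕜]
  [AddCommGroup V] [Module K V] [Module 𝕜 V] [IsScalarTower K 𝕜 V]

theorem VecInIdeal.smul {X : AnalyticGerm 𝕜} {h : (Fin X.dim → 𝕜) → V} (hh : X.VecInIdeal h)
    (c : K) : X.VecInIdeal (fun z => c • h z) := by
  have h := hh.map (algebraMap K 𝕜 c • LinearMap.id)
  simpa only [LinearMap.smul_apply, LinearMap.id_apply, algebraMap_smul] using h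

theorem IsPolyMap.smul {m a b : ℕ} {h : (Fin m → 𝕜) → V} (hh : IsPolyMap a b h) (c : K) :
    IsPolyMap a b (fun z => c • h z) := by
  have h := hh.map (algebraMap K 𝕜 c • LinearMap.id)
  simpa only [LinearMap.smul_apply, LinearMap.id_apply, algebraMap_smul] using h

end AnalyticGerm

/-- The failure of a linear map between Lie algebras to be a homomorphism. -/
def LinearMap.curvature {K 𝔫 𝔤 : Type*} [CommRing K] [LieRing 𝔫] [LieAlgebra K 𝔫]
    [LieRing 𝔤] [LieAlgebra K 𝔤] (f : 𝔫 →ₗ[K] 𝔤) : 𝔫 →ₗ[K] 𝔫 →ₗ[K] 𝔤 :=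
  LinearMap.mk₂ K (fun x y => ⁅f x, f y⁆ - f ⁅x, y⁆)
    (by intros; simp; abel) (by intros; simp [smul_sub]) (by intros; simp; abel)
    (by intros; simp [smul_sub])

theorem LinearMap.curvature_apply {K 𝔫 𝔤 : Type*} [CommRing K] [LieRing 𝔫] [LieAlgebra K 𝔫]
    [LieRing 𝔤] [LieAlgebra K 𝔤] (f : 𝔫 →ₗ[K] 𝔤) (x y : 𝔫) :
    f.curvature x y = ⁅f x, f y⁆ - f ⁅x, y⁆ := rfl

theorem LinearMap.curvature_lie_left {K 𝔫 𝔤 : Type*} [CommRing K] [LieRing 𝔫] [LieAlgebra K 𝔫]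
    [LieRing 𝔤] [LieAlgebra K 𝔤] (f : 𝔫 →ₗ[K] 𝔤) (x y w : 𝔫) :
    f.curvature ⁅x, y⁆ w = ⁅f x, f.curvature y w⁆ - ⁅f y, f.curvature x w⁆ +
      f.curvature x ⁅y, w⁆ - f.curvature y ⁅x, w⁆ - ⁅f.curvature x y, f w⁆ := by
  simp only [curvature_apply, lie_sub, sub_lie, lie_lie, map_sub]
  abel

namespace LieWord

theorem isPolyMap_eval {𝕜 𝔤 : Type*} [RCLike 𝕜] [LieRing 𝔤] [LieAlgebra 𝕜 𝔤]
    [FiniteDimensional 𝕜 𝔤] {m r : ℕ} (Z : (Fin m → 𝕜) →ₗ[𝕜] (Fin r → 𝔤))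
    (t : Fin r) (T : List (Fin r)) :
    AnalyticGerm.IsPolyMap (T.length + 1) (T.length + 1) (fun z => eval (Z z) t T) := by
  have h : ∀ s, AnalyticGerm.IsPolyMap 1 1 (fun z => Z z s) := fun s =>
    (LinearMap.proj s ∘ₗ Z).isPolyMap
  induction T with
  | nil => exact h t
  | cons s T ih => exact ((h s).lie ih).mono (by simp) (by simp; omega)

theorem eval_zero {ι L : Type*} [LieRing L] (t : ι) (T : List ι) :
    eval (0 : ι → L) t T = 0 := by
  cases T <;> simp [eval]

end LieWord

namespace LieWord.Presentation

variable {K 𝕜 𝔫 𝔤 : Type*} [RCLike K] [RCLike 𝕜] [Algebra K 𝕜]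
  [LieRing 𝔫] [LieAlgebra K 𝔫]
  [LieRing 𝔤] [LieAlgebra K 𝔤]
  {ν : ℕ} (P : Presentation K 𝔫 ν)

/-- The linear map with prescribed values on the generators that is compatible with the words
chosen by the presentation. -/
def extend (z : Fin P.rank → 𝔤) : 𝔫 →ₗ[K] 𝔤 :=
  Fintype.linearCombination K z ∘ₗ P.τ +
    Finsupp.linearCombination K (fun T : Index P.rank ν => eval z T.1.1 T.1.2) ∘ₗ P.σ

theorem extend_apply (z : Fin P.rank → 𝔤) (x : 𝔫) :
    P.extend z x = ∑ t, P.τ x t • z t +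
      ∑ T ∈ (P.σ x).support, P.σ x T • eval z T.1.1 T.1.2 := by
  simp [extend, Fintype.linearCombination_apply, Finsupp.linearCombination_apply, Finsupp.sum]

theorem extend_u (z : Fin P.rank → 𝔤) (t : Fin P.rank) : P.extend z (P.u t) = z t := by
  simp [extend_apply, τ_u, σ_u, Pi.single_apply]

theorem extend_zero : P.extend (0 : Fin P.rank → 𝔤) = 0 := by
  ext x
  simp [extend_apply, eval_zero]

theorem pos (hν : LieModule.lowerCentralSeries K 𝔫 𝔫 ν = ⊥) (t : Fin P.rank) : 0 < ν := by
  rcases Nat.eq_zero_or_pos ν with rfl | h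
  · have hu : P.u t = 0 := by
      have : P.u t ∈ LieModule.lowerCentralSeries K 𝔫 𝔫 0 := by simp
      rwa [hν, LieSubmodule.mem_bot] at this
    have := congrFun (P.τ_u t) t
    simp [hu] at this
  · exact h

section Polynomial

open AnalyticGerm

variable [LieAlgebra 𝕜 𝔤] [IsScalarTower K 𝕜 𝔤] [FiniteDimensional 𝕜 𝔤]
  {m : ℕ} (Z : (Fin m → 𝕜) →ₗ[𝕜] (Fin P.rank → 𝔤))

theorem isPolyMap_extend_words (x : 𝔫) :
    IsPolyMap 2 ν (fun z => ∑ T ∈ (P.σ x).support, P.σ x T • eval (Z z) T.1.1 T.1.2) :=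
  .sum fun T _ => ((isPolyMap_eval Z _ _).smul _).mono (by have := T.2.1; omega)
    (by have := T.2.2; omega)

theorem isPolyMap_extend_lie (x y : 𝔫) : IsPolyMap 2 ν (fun z => P.extend (Z z) ⁅x, y⁆) := by
  simpa [extend_apply, τ_lie] using P.isPolyMap_extend_words Z ⁅x, y⁆

theorem isPolyMap_extend (hν : 0 < ν) (x : 𝔫) : IsPolyMap 1 ν (fun z => P.extend (Z z) x) := by
  have h := (IsPolyMap.sum (s := Finset.univ) fun t _ =>
    ((LinearMap.proj t ∘ₗ Z).isPolyMap.mono le_rfl hν).smul (P.τ x t)).sub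
      (((P.isPolyMap_extend_words Z x).mono one_le_two le_rfl).smul (-1 : K))
  simpa [extend_apply] using h

theorem vecAnalytic_extend (hν : LieModule.lowerCentralSeries K 𝔫 𝔫 ν = ⊥) (x : 𝔫) :
    VecAnalytic (fun z => P.extend (Z z) x) := by
  by_cases h : 0 < ν
  · exact (P.isPolyMap_extend Z h x).vecAnalytic
  · have : IsEmpty (Fin P.rank) := ⟨fun t => h (P.pos hν t)⟩
    have hZ : ∀ z, Z z = 0 := fun z => Subsingleton.elim _ _
    simp only [hZ]
    exact fun l => analyticAt_const

theorem isPolyMap_curvature (hν : 0 < ν) (t : Fin P.rank) (x : 𝔫) :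
    IsPolyMap 2 (ν + 1) (fun z => (P.extend (Z z)).curvature (P.u t) x) := by
  simp only [LinearMap.curvature_apply, extend_u]
  refine IsPolyMap.sub ?_ ((P.isPolyMap_extend_lie Z _ _).mono le_rfl (Nat.le_succ ν))
  exact ((LinearMap.proj t ∘ₗ Z).isPolyMap.lie (P.isPolyMap_extend Z hν x)).mono le_rfl
    (by omega)

end Polynomial

section Ideal

open AnalyticGerm

variable [LieAlgebra 𝕜 𝔤] [IsScalarTower K 𝕜 𝔤] [FiniteDimensional 𝕜 𝔤] {X : AnalyticGerm 𝕜}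
  {f : (Fin X.dim → 𝕜) → 𝔫 →ₗ[K] 𝔤}

/-- A family of linear maps is a homomorphism modulo an ideal if it is compatible with brackets
with generators. -/
theorem vecInIdeal_curvature (hf : ∀ x, VecAnalytic (fun z => f z x))
    (h : ∀ t x, X.VecInIdeal (fun z => (f z).curvature (P.u t) x)) (x y : 𝔫) :
    X.VecInIdeal (fun z => (f z).curvature x y) := by
  induction x using P.induction generalizing y with
  | u t => exact h t y
  | zero => simpa using VecInIdeal.zero
  | add x x' hx hx' => simpa using (hx y).add (hx' y)
  | smul c x hx => simpa using (hx y).smul c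
  | lie t x hx =>
    simp only [LinearMap.curvature_lie_left]
    exact (((((hx y).lie_right (hf _)).sub ((h t y).lie_right (hf _))).add (h t _)).sub
      (hx _)).sub ((h t x).lie_left (hf _))

/-- A homomorphism modulo an ideal is determined modulo this ideal by its values on generators. -/
theorem vecInIdeal_extend_sub (hf : ∀ x, VecAnalytic (fun z => f z x))
    (h : ∀ x y, X.VecInIdeal (fun z => (f z).curvature x y)) (x : 𝔫) :
    X.VecInIdeal (fun z => P.extend (fun t => f z (P.u t)) x - f z x) := by
  have hw : ∀ t T, X.VecInIdeal
      (fun z => eval (fun t => f z (P.u t)) t T - f z (eval P.u t T)) := by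
    intro t T
    induction T with
    | nil => simpa [eval] using VecInIdeal.zero
    | cons s T ih =>
      have := (ih.lie_right (hf (P.u s))).add (h (P.u s) (eval P.u t T))
      simpa [LinearMap.curvature_apply, eval] using this
  have key : ∀ z, P.extend (fun t => f z (P.u t)) x - f z x =
      ∑ T ∈ (P.σ x).support, P.σ x T •
        (eval (fun t => f z (P.u t)) T.1.1 T.1.2 - f z (eval P.u T.1.1 T.1.2)) := by
    intro z
    rw [extend_apply]
    have hx : f z x = ∑ t, P.τ x t • f z (P.u t) +
        ∑ T ∈ (P.σ x).support, P.σ x T • f z (eval P.u T.1.1 T.1.2) := by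
      conv_lhs => rw [P.eq_sum x]
      simp [Finsupp.linearCombination_apply, Finsupp.sum]
    rw [hx, add_sub_add_left_eq_sub, ← Finset.sum_sub_distrib]
    simp only [smul_sub]
  simp only [key]
  exact VecInIdeal.sum fun T _ => (hw _ _).smul _

end Ideal

end LieWord.Presentation

namespace AnalyticGerm

/-- Polynomial maps with monomials of degrees in `[2, r]` define a germ given by polynomials of
degree at most `r` without constant and linear terms. -/
theorem exists_polynomials {𝕜 : Type*} [RCLike 𝕜] {m r : ℕ} {ι : Type*} [Fintype ι]
    {h : ι → (Fin m → 𝕜) → 𝕜} (hh : ∀ i, IsPolyMap 2 r (h i)) :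
    ∃ (k : ℕ) (e : ι ≃ Fin k) (p : Fin k → MvPolynomial (Fin m) 𝕜)
      (_ : ∀ j, (p j).coeff 0 = 0), (∀ j, (p j).totalDegree ≤ r) ∧
      (∀ j i, (p j).coeff (Finsupp.single i 1) = 0) ∧
      ∀ i z, MvPolynomial.eval z (p (e i)) = h i z := by
  choose p hp hpl using fun i => hh i LinearMap.id
  let e := Fintype.equivFin ι
  refine ⟨_, e, fun j => p (e.symm j), fun j => ?_, fun j => ?_, fun j i => ?_, fun i z => ?_⟩
  · by_contra h0
    have := (hp _ 0 (MvPolynomial.mem_support_iff.2 h0)).1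
    simp at this
  · exact Finset.sup_le fun d hd => (hp _ d hd).2
  · by_contra h0
    have := (hp _ _ (MvPolynomial.mem_support_iff.2 h0)).1
    simp at this
  · simpa using hpl i z

end AnalyticGerm

open AnalyticGerm MaurerCartan LieWord in
/-- The Maurer–Cartan germ of a `ν`-step nilpotent Lie algebra is cut out in degree `ν + 1`.
No grading is needed: the values of `ω` on generators satisfy the equations that `ω` is compatible
with brackets with generators, which by the Jacobi identity imply the full Maurer–Cartan equation. -/
theorem MaurerCartan.isCutOutInDegree_mcGerm {K 𝕜 : Type*} [RCLike K] [RCLike 𝕜] [Algebra K 𝕜]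
    {𝔫 : Type*} [LieRing 𝔫] [LieAlgebra K 𝔫] [FiniteDimensional K 𝔫]
    {𝔤 : Type*} [LieRing 𝔤] [LieAlgebra K 𝔤] [LieAlgebra 𝕜 𝔤] [IsScalarTower K 𝕜 𝔤]
    [FiniteDimensional 𝕜 𝔤] {ν : ℕ} (hν : LieModule.lowerCentralSeries K 𝔫 𝔫 ν = ⊥)
    {N M : ℕ} (b : Module.Basis (Fin N) 𝕜 (L1 K 𝔫 𝔤))
    (c : Module.Basis (Fin M) 𝕜 (L2 K 𝔫 𝔤)) :
    (mcGerm b c).IsCutOutInDegree (ν + 1) := by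
  obtain ⟨P⟩ := Presentation.nonempty hν
  let e := Module.finBasis K 𝔫
  let bg := Module.finBasis 𝕜 𝔤
  let Z := (Module.finBasis 𝕜 (Fin P.rank → 𝔤)).equivFun.symm
  obtain ⟨k, σ, p, hp, hdeg, hlin, heval⟩ := exists_polynomials
    (h := fun (i : Fin P.rank × Fin (Module.finrank K 𝔫) × Fin (Module.finrank 𝕜 𝔤)) z =>
      bg.coord i.2.2 ((P.extend (Z z)).curvature (P.u i.1) (e i.2.1))) (r := ν + 1)
    fun i => (P.isPolyMap_curvature Z.toLinearMap (P.pos hν i.1) i.1 _).map (bg.coord _)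
  refine ⟨_, k, p, hp, hdeg, hlin, ?_⟩
  set X := mcGerm b c
  set Y := ofPolynomials p hp
  let ω : (Fin X.dim → 𝕜) →ₗ[𝕜] L1 K 𝔫 𝔤 := b.equivFun.symm.toLinearMap
  have hXeqn : ∀ j, X.eqn j = fun w => c.repr (mcMap K 𝕜 𝔫 𝔤 (ω w)) j := fun j =>
    funext fun w => by
      rw [show ω w = ∑ i, w i • b i from b.equivFun_symm_apply w]
      rfl
  let f : (Fin X.dim → 𝕜) → 𝔫 →ₗ[K] 𝔤 := fun w =>
    { toFun x := evalOne K 𝕜 x (ω w)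
      map_add' x y := evalOne_add K x y _
      map_smul' s x := evalOne_smul K s x _ }
  have hf : ∀ x, VecAnalytic (fun w => f w x) := fun x => (evalOne K 𝕜 x ∘ₗ ω).vecAnalytic
  have hfX : ∀ x y, X.VecInIdeal (fun w => (f w).curvature x y) := by
    intro x y
    have h : X.VecInIdeal (fun w => mcMap K 𝕜 𝔫 𝔤 (ω w)) :=
      vecInIdeal_of_basis c fun j => by
        have h := InIdeal.eqn (X := X) j
        rwa [hXeqn j] at h
    have h' := h.map (evalTwo K 𝕜 x y)
    simp only [evalTwo_mcMap] at h'
    exact h'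
  have hfe : ∀ x, X.VecInIdeal (fun w => P.extend (fun t => f w (P.u t)) x - f w x) :=
    P.vecInIdeal_extend_sub hf hfX
  let g : (Fin Y.dim → 𝕜) → 𝔫 →ₗ[K] 𝔤 := fun z => P.extend (Z z)
  have hg : ∀ x, VecAnalytic (fun z => g z x) := P.vecAnalytic_extend Z.toLinearMap hν
  have hgY : ∀ x y, Y.VecInIdeal (fun z => (g z).curvature x y) := by
    refine P.vecInIdeal_curvature hg fun t x => ?_
    have h : ∀ s, Y.VecInIdeal (fun z => (g z).curvature (P.u t) (e s)) := fun s =>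
      vecInIdeal_of_basis bg fun l => by
        have := InIdeal.eqn (X := Y) (σ (t, s, l))
        have h' : Y.eqn (σ (t, s, l)) = fun z => bg.repr ((g z).curvature (P.u t) (e s)) l :=
          funext fun z => heval (t, s, l) z
        rwa [h'] at this
    have hx : ∀ z, (g z).curvature (P.u t) x =
        ∑ s, e.repr x s • (g z).curvature (P.u t) (e s) := fun z => by
      conv_lhs => rw [← e.sum_repr x]
      simp only [map_sum, map_smul]
    simp only [hx]
    exact VecInIdeal.sum fun s _ => (h s).smul _
  let φ : (Fin X.dim → 𝕜) →ₗ[𝕜] (Fin Y.dim → 𝕜) :=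
    Z.symm.toLinearMap ∘ₗ LinearMap.pi fun t => evalOne K 𝕜 (P.u t) ∘ₗ ω
  have hZφ : ∀ w, Z (φ w) = fun t => f w (P.u t) := fun w => Z.apply_symm_apply _
  let ψ : (Fin Y.dim → 𝕜) → (Fin X.dim → 𝕜) := fun z =>
    b.equivFun (ofValues K 𝕜 e fun s => g z (e s))
  have hωψ : ∀ z, ω (ψ z) = ofValues K 𝕜 e fun s => g z (e s) := fun z =>
    b.equivFun.symm_apply_apply _
  have hfψ : ∀ z x, f (ψ z) x = g z x := fun z x => by
    change evalOne K 𝕜 x (ω (ψ z)) = _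
    rw [hωψ, evalOne_ofValues]
  have hgφ : ∀ x, VecAnalytic (fun w => g (φ w) x) :=
    P.vecAnalytic_extend (Z.toLinearMap ∘ₗ φ) hν
  have hgf : ∀ x, X.VecInIdeal (fun w => g (φ w) x - f w x) := fun x => by
    simpa only [g, hZφ] using hfe x
  refine ⟨φ, ψ, ⟨?_, map_zero φ, fun j => ?_⟩, ⟨?_, ?_, fun j => ?_⟩, fun i => ?_, fun i => ?_⟩
  · exact (LinearMap.toContinuousLinearMap φ).analyticAt 0
  · obtain ⟨⟨t, s, l⟩, rfl⟩ := σ.surjective j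
    have h' : (fun w => Y.eqn (σ (t, s, l)) (φ w)) =
        fun w => bg.repr ((g (φ w)).curvature (P.u t) (e s)) l :=
      funext fun w => heval (t, s, l) (φ w)
    rw [h']
    refine VecInIdeal.repr bg ?_ l
    have := ((((hgf (P.u t)).lie_left (hgφ (e s))).add ((hgf (e s)).lie_right (hf (P.u t)))).sub
      (hgf ⁅P.u t, e s⁆)).add (hfX (P.u t) (e s))
    convert this using 2 with w
    simp only [LinearMap.curvature_apply, sub_lie, lie_sub]
    abel
  · have h : VecAnalytic (fun z => ofValues K 𝕜 e fun s => g z (e s)) := by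
      simp only [ofValues_apply, ← tmulRight_apply K 𝕜]
      exact VecAnalytic.sum fun s _ => (hg (e s)).map _
    exact AnalyticAt.pi fun i => h (b.coord i)
  · have h0 : g 0 = 0 := (congrArg P.extend (map_zero Z)).trans P.extend_zero
    simp only [ψ, h0, LinearMap.zero_apply]
    exact (congrArg b.equivFun (map_zero (ofValues K 𝕜 e))).trans (map_zero _)
  · have h : Y.VecInIdeal (fun z => mcMap K 𝕜 𝔫 𝔤 (ω (ψ z))) := by
      have hc : ∀ z x y, evalTwo K 𝕜 x y (mcMap K 𝕜 𝔫 𝔤 (ω (ψ z))) = (g z).curvature x y :=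
        fun z x y => by
          have h := fun x => hfψ z x
          simp only [f, LinearMap.coe_mk, AddHom.coe_mk] at h
          rw [evalTwo_mcMap, h, h, h, LinearMap.curvature_apply]
      have hs : ∀ z, mcMap K 𝕜 𝔫 𝔤 (ω (ψ z)) = ∑ i, ∑ j, tmulRight K 𝕜
          ((1 / 2 : K) • wedge K 𝔫 (e.coord i) (e.coord j)) ((g z).curvature (e i) (e j)) :=
        fun z => by
          simp only [← hc, tmulRight_apply]
          exact (sum_evalTwo_tmul_wedge K 𝕜 e _).symm
      simp only [hs]
      exact VecInIdeal.sum fun i _ => VecInIdeal.sum fun j _ => (hgY _ _).map _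
    simpa only [hXeqn] using h.repr c j
  · have h : X.VecInIdeal (fun w => ω (ψ (φ w)) - ω w) := by
      have hs : ∀ w, ω (ψ (φ w)) - ω w =
          ∑ s, tmulRight K 𝕜 (e.coord s) (g (φ w) (e s) - f w (e s)) := fun w => by
        rw [hωψ]
        conv_lhs => rw [← ofValues_evalOne K 𝕜 e (ω w)]
        simp only [ofValues_apply, ← Finset.sum_sub_distrib, map_sub, tmulRight_apply]
        rfl
      simp only [hs]
      exact VecInIdeal.sum fun s _ => (hgf (e s)).map _
    have h' := h.repr b i
    convert h' using 2 with w
    rw [← map_sub]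
    exact (congrFun (b.equivFun.apply_symm_apply (ψ (φ w) - w)) i).symm
  · have h : ∀ z, φ (ψ z) = z := fun z => by
      apply Z.injective
      rw [hZφ]
      funext t
      rw [hfψ]
      exact P.extend_u _ t
    simpa [h] using InIdeal.zero

/-- The result for naturally graded Lie algebras is a special case of
`MaurerCartan.isCutOutInDegree_mcGerm`. -/
theorem mainTheorem2 {K 𝕜 : Type*} [RCLike K] [RCLike 𝕜] [Algebra K 𝕜]
    {𝔫 : Type*} [LieRing 𝔫] [LieAlgebra K 𝔫] [FiniteDimensional K 𝔫]
    {𝔤 : Type*} [LieRing 𝔤] [LieAlgebra K 𝔤] [LieAlgebra 𝕜 𝔤] [IsScalarTower K 𝕜 𝔤]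
    [FiniteDimensional 𝕜 𝔤]
    (ν : ℕ) (hν : IsStepNilpotent K 𝔫 ν) (hgr : IsNaturallyGraded K 𝔫)
    {N M : ℕ} (b : Module.Basis (Fin N) 𝕜 (MaurerCartan.L1 K 𝔫 𝔤))
    (c : Module.Basis (Fin M) 𝕜 (MaurerCartan.L2 K 𝔫 𝔤)) :
    (MaurerCartan.mcGerm b c).IsCutOutInDegree (ν + 1) :=
  MaurerCartan.isCutOutInDegree_mcGerm hν.1 b c

end
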